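/- Let $R$ be a unital associative ring. A right Gabriel filter on a ring $A$ is a nonempty set $\mathcal F$ of right ideals of $A$ such that (i) if $I\in\mathcal F$ and $a\in A$, then $(a:I)=\{b\in A\mid ab\in I\}\in\mathcal F$; (ii) if $I\in\mathcal F$ and $J$ is a right ideal with $(a:J)\in\mathcal F$ for all $a\in I$, then $J\in\mathcal F$. Left Gabriel filters are defined dually. A left (right) module is torsion for a left (right) Gabriel filter if the annihilator of each of its elements belongs to the filter; every module $M$ has a largest torsion submodule. Regard $R$-bimodules as right modules over $R\otimes_{\mathbb Z}R^{op}$ via $m\cdot(r\otimes s)=smr$. The symmetric filter ${}_l\mathcal F_r$ induced by a left Gabriel filter $\mathcal F_l$ and a right Gabriel filter $\mathcal F_r$ on $R$ is the Gabriel filter of all right ideals $K$ of $R\otimes_{\mathbb Z}R^{op}$ such that the bimodule $(R\otimes_{\mathbb Z} R^{op})/K$ is torsion both for $\mathcal F_l$ as a left $R$-module and for $\mathcal F_r$ as a right $R$-module. For an $R$-bimodule $M$, let ${}_l\mathcal T_r(M)$ be its torsion sub-bimodule for ${}_l\mathcal F_r$ (the set of elements whose left and right annihilators belong to $\mathcal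 F_l$ and $\mathcal F_r$ respectively). The symmetric module of quotients is the $R$-bimodule $${}_lM_r=\varinjlim_{K\in{}_l\mathcal F_r}\operatorname{Hom}_{R\otimes R^{op}}\bigl(K,\,M/{}_l\mathcal T_r(M)\bigr),$$ with action $(f\cdot a)(b)=f(ab)$ for $a\in R\otimes_{\mathbb Z}R^{op}$, and $q_M:M\to{}_lM_r$ is the canonical map sending $m$ to the class of $a\mapsto (m+{}_l\mathcal T_r(M))\cdot a$. A higher derivation on $R$ is a family $\Delta=\{\delta_n\}_{n\ge 0}$ of additive maps $R\to R$ with $\delta_0=\mathrm{id}$ and $\delta_n(rs)=\sum_{i=0}^n\delta_i(r)\delta_{n-i}(s)$ for all $n$, $r$, $s$. It induces additive maps $\overline{\delta}_n$ on $R\otimes_{\mathbb Z}R^{op}$, $\overline{\delta}_n(r\otimes s)=\sum_{i=0}^n\delta_i(r)\otimes\delta_{n-i}(s)$. A $\Delta$-higher derivation on an $R$-bimodule $M$ is a family $D=\{d_n\}_{n\ge 0}$ of additive maps $M\to M$ with $d_0=\mathrm{id}$, $d_n(xr)=\sum_{i=0}^n d_i(x)\delta_{n-i}(r)$ and $d_n(rx)=\sum_{i=0}^n\delta_i(r)d_{n-i}(x)$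 for all $n$, $x\in M$, $r\in R$. An extension of $D$ to ${}_lM_r$ is a $\Delta$-higher derivation $D'=\{d'_n\}$ on ${}_lM_r$ with $d'_nq_M=q_Md_n$ for all $n$. 1. Every symmetric filter ${}_l\mathcal F_r$ is higher derivation invariant: for every higher derivation $\Delta$ on $R$, every $K\in{}_l\mathcal F_r$ and every $n$ there is $J\in{}_l\mathcal F_r$ such that $\overline{\delta}_i(J)\subseteq K$ for all $i\le n$. 2. For every symmetric filter ${}_l\mathcal F_r$, every higher derivation $\Delta$ on $R$ and every $R$-bimodule $M$, every $\Delta$-higher derivation $D$ on $M$ has a unique extension to ${}_lM_r$. 3. Let ${}_l\mathcal F_r^1\subseteq{}_l\mathcal F_r^2$ be symmetric filters on $R$, each induced by a left and a right Gabriel filter, let $\Delta$ be a higher derivation on $R$, $M$ an $R$-bimodule, and $D$ a $\Delta$-higher derivation on $M$. Let $q_1:M\to{}_lM_r^1$ and $q_2:M\to{}_lM_r^2$ be the canonical maps into the two symmetric modules of quotients, and let $q_{12}:{}_lM_r^1\to{}_lM_r^2$ be the map induced by the inclusion of the filters. Then the extensions $\{d^1_n\}$ and $\{d^2_n\}$ of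 $D$ to ${}_lM_r^1$ and ${}_lM_r^2$ agree: $q_{12}q_1=q_2$, $d_n^jq_j=q_jd_n$ for $j=1,2$, and $q_{12}d^1_n=d^2_nq_{12}$ for all $n$. -/

import Mathlib

open MulOpposite TensorProduct

universe u v

/-! Right modules over a ring `A` are modules over `Aᵐᵒᵖ`; the right action `m · a` is `op a • m`.
Right ideals of `A` are elements of `Submodule Aᵐᵒᵖ A`, left ideals are elements of `Ideal A`. -/

section Residuals

variable {A : Type u} [Ring A] {M : Type v} [AddCommGroup M]

/-- The right ideal `(m : N) = {a | m · a ∈ N}` for a submodule `N` of a right module. -/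
def rightResidual [Module Aᵐᵒᵖ M] (m : M) (N : Submodule Aᵐᵒᵖ M) : Submodule Aᵐᵒᵖ A where
  carrier := {a | op a • m ∈ N}
  add_mem' {a b} ha hb := by
    simpa only [Set.mem_ofPred_eq, op_add, add_smul] using N.add_mem ha hb
  zero_mem' := by simp
  smul_mem' c a ha := by
    have h : op (c • a) = c * op a := by
      rw [← op_unop c, op_smul_eq_mul, op_mul]
    simpa only [Set.mem_ofPred_eq, h, mul_smul] using N.smul_mem c ha

/-- The left ideal `{a | a · m ∈ N}` for a submodule `N` of a left module. -/
def leftResidual [Module A M] (m : M) (N : Submodule A M) : Ideal A where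
  carrier := {a | a • m ∈ N}
  add_mem' {a b} ha hb := by
    simpa only [Set.mem_ofPred_eq, add_smul] using N.add_mem ha hb
  zero_mem' := by simp
  smul_mem' c a ha := by
    simpa only [Set.mem_ofPred_eq, smul_eq_mul, mul_smul] using N.smul_mem c ha

@[simp] theorem mem_rightResidual [Module Aᵐᵒᵖ M] {m : M} {N : Submodule Aᵐᵒᵖ M} {a : A} :
    a ∈ rightResidual m N ↔ op a • m ∈ N := Iff.rfl

@[simp] theorem mem_leftResidual [Module A M] {m : M} {N : Submodule A M} {a : A} :
    a ∈ leftResidual m N ↔ a • m ∈ N := Iff.rfl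

end Residuals

/-- A Gabriel filter of right ideals of `A`. -/
structure RightGabrielFilter (A : Type u) [Ring A] where
  ideals : Set (Submodule Aᵐᵒᵖ A)
  nonempty : ideals.Nonempty
  residual_mem : ∀ I ∈ ideals, ∀ a : A, rightResidual a I ∈ ideals
  mem_of_residual : ∀ I ∈ ideals, ∀ J : Submodule Aᵐᵒᵖ A,
    (∀ a ∈ I, rightResidual a J ∈ ideals) → J ∈ ideals

/-- A Gabriel filter of left ideals of `A`. -/
structure LeftGabrielFilter (A : Type u) [Ring A] where
  ideals : Set (Ideal A)
  nonempty : ideals.Nonempty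
  residual_mem : ∀ I ∈ ideals, ∀ a : A, leftResidual a I ∈ ideals
  mem_of_residual : ∀ I ∈ ideals, ∀ J : Ideal A,
    (∀ a ∈ I, leftResidual a J ∈ ideals) → J ∈ ideals

namespace LeftGabrielFilter

variable {A : Type u} [Ring A] (F : LeftGabrielFilter A)

theorem top_mem : ⊤ ∈ F.ideals := by
  obtain ⟨I, hI⟩ := F.nonempty
  have h : leftResidual (0 : A) I = ⊤ := by ext; simp
  exact h ▸ F.residual_mem I hI 0

theorem mem_of_le {I J : Ideal A} (hI : I ∈ F.ideals) (h : I ≤ J) : J ∈ F.ideals := by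
  refine F.mem_of_residual I hI J fun a ha => ?_
  have : leftResidual a J = ⊤ := by
    ext b; simpa using J.smul_mem b (h ha)
  exact this ▸ F.top_mem

theorem inf_mem {I J : Ideal A} (hI : I ∈ F.ideals) (hJ : J ∈ F.ideals) : I ⊓ J ∈ F.ideals := by
  refine F.mem_of_residual I hI _ fun a ha => F.mem_of_le (F.residual_mem J hJ a) fun b hb => ?_
  exact ⟨I.smul_mem b ha, hb⟩

end LeftGabrielFilter

namespace RightGabrielFilter

variable {A : Type u} [Ring A] (F : RightGabrielFilter A)

theorem top_mem : ⊤ ∈ F.ideals := by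
  obtain ⟨I, hI⟩ := F.nonempty
  have h : rightResidual (0 : A) I = ⊤ := by ext; simp
  exact h ▸ F.residual_mem I hI 0

theorem mem_of_le {I J : Submodule Aᵐᵒᵖ A} (hI : I ∈ F.ideals) (h : I ≤ J) : J ∈ F.ideals := by
  refine F.mem_of_residual I hI J fun a ha => ?_
  have : rightResidual a J = ⊤ := by
    ext b; simpa using J.smul_mem (op b) (h ha)
  exact this ▸ F.top_mem

theorem inf_mem {I J : Submodule Aᵐᵒᵖ A} (hI : I ∈ F.ideals) (hJ : J ∈ F.ideals) :
    I ⊓ J ∈ F.ideals := by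
  refine F.mem_of_residual I hI _ fun a ha => F.mem_of_le (F.residual_mem J hJ a) fun b hb => ?_
  exact ⟨I.smul_mem (op b) ha, hb⟩

variable (M : Type v) [AddCommGroup M] [Module Aᵐᵒᵖ M]

/-- The torsion submodule: the elements whose annihilator `(m : 0)` is in the filter. -/
def torsion : Submodule Aᵐᵒᵖ M where
  carrier := {m | rightResidual m ⊥ ∈ F.ideals}
  add_mem' {x y} hx hy := by
    refine F.mem_of_le (F.inf_mem hx hy) ?_
    rintro a ⟨h1, h2⟩
    have h1' : op a • x = 0 := h1
    have h2' : op a • y = 0 := h2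
    simp [h1', h2']
  zero_mem' := by
    refine F.mem_of_le F.top_mem ?_
    intro a _
    simp
  smul_mem' c x hx := by
    refine F.mem_of_le (F.residual_mem _ hx (unop c)) ?_
    intro a ha
    have h : op (unop c * a) • x = 0 := ha
    rw [op_mul, op_unop, mul_smul] at h
    simpa using h

/-- The ideals of the filter, ordered by reverse inclusion. -/
abbrev Index : Type u := (F.ideals : Set (Submodule Aᵐᵒᵖ A))ᵒᵈ

/-- The right ideal of an index. -/
abbrev idealOf (i : F.Index) : Submodule Aᵐᵒᵖ A := (OrderDual.ofDual i).1

/-- The index of a right ideal in the filter. -/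
abbrev index (I : Submodule Aᵐᵒᵖ A) (hI : I ∈ F.ideals) : F.Index := OrderDual.toDual ⟨I, hI⟩

instance : Nonempty F.Index := ⟨F.index ⊤ F.top_mem⟩

instance : IsDirectedOrder F.Index where
  directed i j := ⟨F.index _ (F.inf_mem i.2 j.2), fun _ h => h.1, fun _ h => h.2⟩

variable {F} in
theorem index_le {i j : F.Index} (h : F.idealOf j ≤ F.idealOf i) : i ≤ j := h

variable {F} in
theorem idealOf_le {i j : F.Index} (h : i ≤ j) : F.idealOf j ≤ F.idealOf i := h

/-- `Hom(I, M/t(M))`. -/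
abbrev HomOn (i : F.Index) : Type (max u v) := F.idealOf i →ₗ[Aᵐᵒᵖ] (M ⧸ F.torsion M)

/-- Restriction of homomorphisms to a smaller ideal. -/
def restrict (i j : F.Index) (h : i ≤ j) : F.HomOn M i →+ F.HomOn M j where
  toFun f := f.comp (Submodule.inclusion (p := F.idealOf j) (p' := F.idealOf i) h)
  map_zero' := rfl
  map_add' _ _ := rfl

instance : DirectedSystem (F.HomOn M) (F.restrict M · · ·) where
  map_self _ _ := rfl
  map_map _ _ _ _ _ _ := rfl

/-- The module of quotients `lim_{I ∈ F} Hom(I, M/t(M))`. -/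
def ModuleOfQuotients : Type (max u v) := DirectLimit (F.HomOn M) (F.restrict M)

noncomputable instance instAddCommGroupQuotients : AddCommGroup (F.ModuleOfQuotients M) :=
  inferInstanceAs (AddCommGroup (DirectLimit (F.HomOn M) (F.restrict M)))

variable {M}

/-- The class in the module of quotients of a homomorphism `I → M/t(M)`. -/
def ofHom (i : F.Index) (f : F.HomOn M i) : F.ModuleOfQuotients M :=
  (⟦⟨i, f⟩⟧ : DirectLimit (F.HomOn M) (F.restrict M))

theorem ofHom_eq_ofHom {i j : F.Index} (k : F.Index) (hi : i ≤ k) (hj : j ≤ k) {f : F.HomOn M i}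
    {g : F.HomOn M j} (h : ∀ x (hx : x ∈ F.idealOf k), f ⟨x, hi hx⟩ = g ⟨x, hj hx⟩) :
    F.ofHom i f = F.ofHom j g :=
  Quotient.sound ⟨k, hi, hj, LinearMap.ext fun x => h x.1 x.2⟩

theorem ofHom_add (i : F.Index) (f g : F.HomOn M i) : F.ofHom i (f + g) = F.ofHom i f + F.ofHom i g :=
  (DirectLimit.add_def (f := F.restrict M) i f g).symm

theorem ofHom_surj (x : F.ModuleOfQuotients M) : ∃ i f, x = F.ofHom i f :=
  DirectLimit.exists_eq_mk (F.restrict M) x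

theorem ofHom_surj₂ (x y : F.ModuleOfQuotients M) : ∃ i f g, x = F.ofHom i f ∧ y = F.ofHom i g :=
  DirectLimit.exists_eq_mk₂ (F.restrict M) x y

/-- For `f : I → M/t(M)`, the homomorphism `f · a : (a : I) → M/t(M)`, `b ↦ f (a b)`. -/
def homSMul (a : A) (i : F.Index) (f : F.HomOn M i) :
    F.HomOn M (F.index (rightResidual a (F.idealOf i)) (F.residual_mem _ i.2 a)) where
  toFun b := f ⟨a * b.1, b.2⟩
  map_add' b c := by
    rw [← map_add]; congr 1; exact Subtype.ext (mul_add a b.1 c.1)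
  map_smul' c b := by
    rw [RingHom.id_apply, ← map_smul]; congr 1
    exact Subtype.ext (mul_assoc a b.1 (unop c)).symm

/-- The right action of `A` on the module of quotients, `[f] · a = [f · a]`. -/
noncomputable instance instSMulQuotients : SMul Aᵐᵒᵖ (F.ModuleOfQuotients M) where
  smul c x := DirectLimit.lift (F.restrict M)
    (fun i f => F.ofHom _ (F.homSMul (unop c) i f))
    (fun i j h f => by
      refine F.ofHom_eq_ofHom (F.index _ (F.residual_mem _ j.2 (unop c)))
        (index_le fun b hb => ?_) le_rfl fun _ _ => rfl
      change unop c * b ∈ F.idealOf i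
      exact idealOf_le h hb) x

theorem smul_ofHom (c : Aᵐᵒᵖ) (i : F.Index) (f : F.HomOn M i) :
    c • F.ofHom i f = F.ofHom _ (F.homSMul (unop c) i f) := rfl

noncomputable instance instModuleQuotients : Module Aᵐᵒᵖ (F.ModuleOfQuotients M) where
  one_smul x := by
    obtain ⟨i, f, rfl⟩ := F.ofHom_surj x
    rw [smul_ofHom]
    refine F.ofHom_eq_ofHom i (index_le fun b hb => ?_) le_rfl fun b hb => ?_
    · change (1 : A) * b ∈ F.idealOf i
      rwa [one_mul]
    · change f ⟨(1 : A) * b, _⟩ = _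
      congr 1
      exact Subtype.ext (one_mul b)
  mul_smul c d x := by
    obtain ⟨i, f, rfl⟩ := F.ofHom_surj x
    simp only [smul_ofHom]
    refine F.ofHom_eq_ofHom _ (index_le fun b hb => ?_) le_rfl fun b hb => ?_
    · change unop d * unop c * b ∈ F.idealOf i
      rw [mul_assoc]; exact hb
    · change f ⟨unop d * unop c * b, _⟩ = f ⟨unop d * (unop c * b), _⟩
      congr 1
      exact Subtype.ext (mul_assoc _ _ _)
  smul_zero c := by
    have h : F.ofHom (Classical.arbitrary F.Index) 0 = (0 : F.ModuleOfQuotients M) :=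
      (DirectLimit.zero_def (f := F.restrict M) _).symm
    rw [← h, smul_ofHom]
    refine F.ofHom_eq_ofHom (F.index _ (F.inf_mem (F.residual_mem _ (Classical.arbitrary F.Index).2
      (unop c)) (Classical.arbitrary F.Index).2)) (index_le inf_le_left) (index_le inf_le_right)
      fun _ _ => rfl
  smul_add c x y := by
    obtain ⟨i, f, g, rfl, rfl⟩ := F.ofHom_surj₂ x y
    rw [← ofHom_add, smul_ofHom, smul_ofHom, smul_ofHom, ← ofHom_add]
    rfl
  add_smul c d x := by
    obtain ⟨i, f, rfl⟩ := F.ofHom_surj x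
    let k : F.Index := F.index _ (F.inf_mem (F.residual_mem _ i.2 (unop c))
      (F.residual_mem _ i.2 (unop d)))
    rw [smul_ofHom, smul_ofHom, smul_ofHom,
      F.ofHom_eq_ofHom (f := F.homSMul (unop c) i f)
        (g := F.restrict M _ k (index_le inf_le_left) (F.homSMul (unop c) i f)) k (index_le inf_le_left) le_rfl
        fun _ _ => rfl,
      F.ofHom_eq_ofHom (f := F.homSMul (unop d) i f)
        (g := F.restrict M _ k (index_le inf_le_right) (F.homSMul (unop d) i f)) k (index_le inf_le_right) le_rfl
        fun _ _ => rfl, ← ofHom_add]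
    refine F.ofHom_eq_ofHom k (index_le fun b hb => ?_) le_rfl fun b hb => ?_
    · change (unop c + unop d) * b ∈ F.idealOf i
      rw [add_mul]; exact (F.idealOf i).add_mem hb.1 hb.2
    · change f ⟨(unop c + unop d) * b, _⟩ = f ⟨unop c * b, hb.1⟩ + f ⟨unop d * b, hb.2⟩
      rw [← map_add]
      congr 1
      exact Subtype.ext (add_mul _ _ _)
  zero_smul x := by
    obtain ⟨i, f, rfl⟩ := F.ofHom_surj x
    have h : F.ofHom i 0 = (0 : F.ModuleOfQuotients M) :=
      (DirectLimit.zero_def (f := F.restrict M) _).symm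
    rw [← h, smul_ofHom]
    refine F.ofHom_eq_ofHom i (index_le fun b _ => ?_) le_rfl fun b hb => ?_
    · change (0 : A) * b ∈ F.idealOf i
      rw [zero_mul]; exact zero_mem _
    · change f ⟨(0 : A) * b, _⟩ = 0
      rw [← map_zero f]
      congr 1
      exact Subtype.ext (zero_mul b)

/-- The homomorphism `A → M/t(M)`, `a ↦ [m] · a`. -/
def homOfElem (m : M) : F.HomOn M (F.index ⊤ F.top_mem) where
  toFun a := op a.1 • (F.torsion M).mkQ m
  map_add' a b := by
    change op (a.1 + b.1) • (F.torsion M).mkQ m = _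
    rw [op_add, add_smul]
  map_smul' c a := by
    change op (a.1 * unop c) • (F.torsion M).mkQ m = _
    rw [op_mul, op_unop, mul_smul, RingHom.id_apply]

variable (M) in
/-- The canonical map `q_M : M → M_F`. -/
noncomputable def toQuotients : M →ₗ[Aᵐᵒᵖ] F.ModuleOfQuotients M where
  toFun m := F.ofHom _ (F.homOfElem m)
  map_add' x y := by
    rw [← ofHom_add]
    congr 1
    ext a
    change op a.1 • (F.torsion M).mkQ (x + y) =
      op a.1 • (F.torsion M).mkQ x + op a.1 • (F.torsion M).mkQ y
    rw [map_add, smul_add]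
  map_smul' c x := by
    rw [RingHom.id_apply, smul_ofHom]
    refine F.ofHom_eq_ofHom (F.index ⊤ F.top_mem) le_rfl (index_le fun b _ => ?_) fun b hb => ?_
    · change unop c * b ∈ (⊤ : Submodule Aᵐᵒᵖ A)
      trivial
    change op b • (F.torsion M).mkQ (c • x) = op (unop c * b) • (F.torsion M).mkQ x
    rw [map_smul, op_mul, op_unop, mul_smul]

theorem torsion_mono {F G : RightGabrielFilter A} (h : F.ideals ⊆ G.ideals) :
    F.torsion M ≤ G.torsion M := fun _ hx => h hx

/-- For `F ⊆ G`, the map `Hom(I, M/t_F(M)) → Hom(I, M/t_G(M))`. -/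
def homChange {F G : RightGabrielFilter A} (h : F.ideals ⊆ G.ideals) (i : F.Index)
    (f : F.HomOn M i) : G.HomOn M (G.index (F.idealOf i) (h i.2)) :=
  (Submodule.factor (torsion_mono (M := M) h)).comp f

variable (M) in
/-- For `F ⊆ G`, the induced map `q_{FG} : M_F → M_G`. -/
noncomputable def quotientsMap {F G : RightGabrielFilter A} (h : F.ideals ⊆ G.ideals) :
    F.ModuleOfQuotients M →ₗ[Aᵐᵒᵖ] G.ModuleOfQuotients M where
  toFun := DirectLimit.lift (F.restrict M) (fun i f => G.ofHom _ (homChange h i f))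
    (fun _ j hij _ => G.ofHom_eq_ofHom (G.index _ (h j.2)) hij le_rfl fun _ _ => rfl)
  map_add' x y := by
    obtain ⟨i, f, g, rfl, rfl⟩ := F.ofHom_surj₂ x y
    rw [← ofHom_add]
    change G.ofHom _ (homChange h i (f + g)) = G.ofHom _ (homChange h i f) + G.ofHom _ (homChange h i g)
    rw [← ofHom_add]
    congr 1
    exact LinearMap.comp_add _ _ _
  map_smul' c x := by
    obtain ⟨i, f, rfl⟩ := F.ofHom_surj x
    rfl

end RightGabrielFilter

section Bimodules

variable (R : Type u) [Ring R]

/-- The ring `R ⊗_ℤ R^op`. -/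
abbrev Env : Type u := R ⊗[ℤ] Rᵐᵒᵖ

/-- The ring homomorphism `R^op → (R ⊗ R^op)^op` of `r ↦ r ⊗ 1`; it gives the right `R`-action on a
right `R ⊗ R^op`-module. -/
noncomputable def envRight : Rᵐᵒᵖ →+* (Env R)ᵐᵒᵖ :=
  RingHom.op (Algebra.TensorProduct.includeLeftRingHom : R →+* Env R)

/-- The ring homomorphism `R → (R ⊗ R^op)^op` of `s ↦ 1 ⊗ s`; it gives the left `R`-action on a
right `R ⊗ R^op`-module. -/
noncomputable def envLeft : R →+* (Env R)ᵐᵒᵖ :=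
  (RingHom.op (Algebra.TensorProduct.includeRight : Rᵐᵒᵖ →ₐ[ℤ] Env R).toRingHom).comp
    (RingEquiv.opOp R).toRingHom

theorem envRight_op (r : R) : envRight R (op r) = op (r ⊗ₜ[ℤ] (1 : Rᵐᵒᵖ)) := rfl

theorem envLeft_apply (s : R) : envLeft R s = op ((1 : R) ⊗ₜ[ℤ] op s) := rfl

theorem envLeft_commute_envRight (s : R) (r : Rᵐᵒᵖ) :
    envLeft R s * envRight R r = envRight R r * envLeft R s := by
  rw [← op_unop r, envRight_op, envLeft_apply, ← op_mul, ← op_mul]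
  simp

section Action

variable (M : Type v) [AddCommGroup M] [Module R M] [Module Rᵐᵒᵖ M] [SMulCommClass R Rᵐᵒᵖ M]

/-- The ring homomorphism `(R ⊗ R^op)^op → End(M)` of an `R`-bimodule `M`, given by
`m · (r ⊗ s) = s m r`. -/
noncomputable def envAction : (Env R)ᵐᵒᵖ →+* Module.End ℤ M :=
  (RingEquiv.opOp (Module.End ℤ M)).symm.toRingHom.comp
    (RingHom.op (Algebra.TensorProduct.lift
      ((RingHom.op (Module.toModuleEnd ℤ M : Rᵐᵒᵖ →+* Module.End ℤ M)).comp
        (RingEquiv.opOp R).toRingHom).toIntAlgHom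
      (RingHom.op (Module.toModuleEnd ℤ M : R →+* Module.End ℤ M)).toIntAlgHom
      (fun r s => unop_injective (LinearMap.ext fun m =>
        smul_comm (unop s) (op r) m))).toRingHom)

theorem envAction_tmul (r s : R) (m : M) :
    envAction R M (op (r ⊗ₜ[ℤ] op s)) m = s • op r • m := rfl

/-- An `R`-bimodule as a right `R ⊗ R^op`-module, `m · (r ⊗ s) = s m r`. -/
noncomputable abbrev bimoduleToRight : Module (Env R)ᵐᵒᵖ M := Module.compHom M (envAction R M)

end Action

variable {R}

/-- For a right ideal `K` of `R ⊗ R^op` and `x ∈ R ⊗ R^op`, the right ideal `{r | x · (r ⊗ 1) ∈ K}`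
of `R`: the annihilator of the class of `x` in the right `R`-module `(R ⊗ R^op)/K`. -/
noncomputable def envRightAnn (K : Submodule (Env R)ᵐᵒᵖ (Env R)) (x : Env R) : Submodule Rᵐᵒᵖ R :=
  letI : Module Rᵐᵒᵖ (Env R) := Module.compHom (Env R) (envRight R)
  rightResidual x
    ({ K with smul_mem' := fun r _ h => K.smul_mem (envRight R r) h } : Submodule Rᵐᵒᵖ (Env R))

/-- For a right ideal `K` of `R ⊗ R^op` and `x ∈ R ⊗ R^op`, the left ideal `{s | x · (1 ⊗ s) ∈ K}`
of `R`: the annihilator of the class of `x` in the left `R`-module `(R ⊗ R^op)/K`. -/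
noncomputable def envLeftAnn (K : Submodule (Env R)ᵐᵒᵖ (Env R)) (x : Env R) : Ideal R :=
  letI : Module R (Env R) := Module.compHom (Env R) (envLeft R)
  leftResidual x
    ({ K with smul_mem' := fun r _ h => K.smul_mem (envLeft R r) h } : Submodule R (Env R))

theorem mem_envRightAnn {K : Submodule (Env R)ᵐᵒᵖ (Env R)} {x : Env R} {r : R} :
    r ∈ envRightAnn K x ↔ x * (r ⊗ₜ[ℤ] (1 : Rᵐᵒᵖ)) ∈ K := Iff.rfl

theorem mem_envLeftAnn {K : Submodule (Env R)ᵐᵒᵖ (Env R)} {x : Env R} {s : R} :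
    s ∈ envLeftAnn K x ↔ x * ((1 : R) ⊗ₜ[ℤ] op s) ∈ K := Iff.rfl

/-- The symmetric Gabriel filter induced by a left and a right Gabriel filter on `R`: the right
ideals `K` of `R ⊗ R^op` such that the bimodule `(R ⊗ R^op)/K` is torsion as a left and as a right
`R`-module. -/
def symmetricFilter (Fl : LeftGabrielFilter R) (Fr : RightGabrielFilter R) :
    RightGabrielFilter (Env R) where
  ideals := {K | ∀ x : Env R, envLeftAnn K x ∈ Fl.ideals ∧ envRightAnn K x ∈ Fr.ideals}
  nonempty := by
    refine ⟨⊤, fun x => ⟨?_, ?_⟩⟩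
    · convert Fl.top_mem using 1
      ext; simp [mem_envLeftAnn]
    · convert Fr.top_mem using 1
      ext; simp [mem_envRightAnn]
  residual_mem K hK a x := by
    obtain ⟨h1, h2⟩ := hK (a * x)
    refine ⟨?_, ?_⟩
    · convert h1 using 1
      ext s; simp [mem_envLeftAnn, mul_assoc]
    · convert h2 using 1
      ext s; simp [mem_envRightAnn, mul_assoc]
  mem_of_residual K hK L hL x := by
    refine ⟨Fl.mem_of_residual _ (hK x).1 _ fun s hs => ?_,
      Fr.mem_of_residual _ (hK x).2 _ fun r hr => ?_⟩
    · convert (hL (x * ((1 : R) ⊗ₜ[ℤ] op s)) hs 1).1 using 1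
      ext t
      simp [mem_envLeftAnn, mul_assoc]
    · convert (hL (x * (r ⊗ₜ[ℤ] (1 : Rᵐᵒᵖ))) hr 1).2 using 1
      ext t
      simp [mem_envRightAnn, mul_assoc]

/-- A symmetric filter consists of the right ideals of `R ⊗ R^op` that contain some
`J ⊗ R^op + R ⊗ I` with `I` in the left filter and `J` in the right filter. -/
theorem mem_symmetricFilter_iff (Fl : LeftGabrielFilter R) (Fr : RightGabrielFilter R)
    (K : Submodule (Env R)ᵐᵒᵖ (Env R)) :
    K ∈ (symmetricFilter Fl Fr).ideals ↔ ∃ I ∈ Fl.ideals, ∃ J ∈ Fr.ideals,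
      (∀ s ∈ I, (1 : R) ⊗ₜ[ℤ] op s ∈ K) ∧ (∀ r ∈ J, r ⊗ₜ[ℤ] (1 : Rᵐᵒᵖ) ∈ K) := by
  constructor
  · intro h
    refine ⟨_, (h 1).1, _, (h 1).2, fun s hs => ?_, fun r hr => ?_⟩
    · simpa [mem_envLeftAnn] using hs
    · simpa [mem_envRightAnn] using hr
  · rintro ⟨I, hI, J, hJ, h1, h2⟩ x
    induction x using TensorProduct.induction_on with
    | zero =>
      exact ⟨Fl.mem_of_le Fl.top_mem fun s _ => by simp [mem_envLeftAnn],
        Fr.mem_of_le Fr.top_mem fun r _ => by simp [mem_envRightAnn]⟩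
    | add x y hx hy =>
      refine ⟨Fl.mem_of_le (Fl.inf_mem hx.1 hy.1) fun s hs => ?_,
        Fr.mem_of_le (Fr.inf_mem hx.2 hy.2) fun r hr => ?_⟩
      · rw [mem_envLeftAnn, add_mul]
        exact K.add_mem hs.1 hs.2
      · rw [mem_envRightAnn, add_mul]
        exact K.add_mem hr.1 hr.2
    | tmul a b =>
      refine ⟨Fl.mem_of_le (Fl.residual_mem I hI (unop b)) fun s hs => ?_,
        Fr.mem_of_le (Fr.residual_mem J hJ a) fun r hr => ?_⟩
      · have h := K.smul_mem (op (a ⊗ₜ[ℤ] (1 : Rᵐᵒᵖ))) (h1 (s * unop b) hs)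
        rw [op_smul_eq_mul, Algebra.TensorProduct.tmul_mul_tmul] at h
        rw [mem_envLeftAnn, Algebra.TensorProduct.tmul_mul_tmul]
        simpa using h
      · have h := K.smul_mem (op ((1 : R) ⊗ₜ[ℤ] b)) (h2 (a * r) hr)
        rw [op_smul_eq_mul, Algebra.TensorProduct.tmul_mul_tmul] at h
        rw [mem_envRightAnn, Algebra.TensorProduct.tmul_mul_tmul]
        simpa using h

section SymmetricQuotients

variable (Fl : LeftGabrielFilter R) (Fr : RightGabrielFilter R)
variable (M : Type v) [AddCommGroup M] [Module R M] [Module Rᵐᵒᵖ M] [SMulCommClass R Rᵐᵒᵖ M]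

/-- The torsion submodule of a bimodule for the symmetric filter is the intersection of its left and
right torsion submodules. -/
theorem mem_symmetric_torsion_iff (m : M) :
    m ∈ @RightGabrielFilter.torsion (Env R) _ (symmetricFilter Fl Fr) M _ (bimoduleToRight R M) ↔
      leftResidual m (⊥ : Submodule R M) ∈ Fl.ideals ∧
        rightResidual m (⊥ : Submodule Rᵐᵒᵖ M) ∈ Fr.ideals := by
  refine (mem_symmetricFilter_iff Fl Fr _).trans ?_
  have h1 : ∀ s : R, envAction R M (op ((1 : R) ⊗ₜ[ℤ] op s)) m = s • m := fun s => by
    rw [envAction_tmul, op_one, one_smul]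
  have h2 : ∀ r : R, envAction R M (op (r ⊗ₜ[ℤ] (1 : Rᵐᵒᵖ))) m = op r • m := fun r => by
    rw [← op_one, envAction_tmul, one_smul]
  constructor
  · rintro ⟨I, hI, J, hJ, hs, hr⟩
    exact ⟨Fl.mem_of_le hI fun s h => (h1 s).symm.trans (hs s h),
      Fr.mem_of_le hJ fun r h => (h2 r).symm.trans (hr r h)⟩
  · rintro ⟨hl, hr⟩
    exact ⟨_, hl, _, hr, fun s h => (h1 s).trans h, fun r h => (h2 r).trans h⟩

/-- The symmetric module of quotients
`lim_K Hom(K, M/t(M))`, `K` in the symmetric filter, `Hom` over `R ⊗ R^op`. -/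
def SymmetricQuotients : Type (max u v) :=
  @RightGabrielFilter.ModuleOfQuotients (Env R) _ (symmetricFilter Fl Fr) M _
    (bimoduleToRight R M)

noncomputable instance : AddCommGroup (SymmetricQuotients Fl Fr M) :=
  @RightGabrielFilter.instAddCommGroupQuotients (Env R) _ (symmetricFilter Fl Fr) M _
    (bimoduleToRight R M)

noncomputable instance : Module (Env R)ᵐᵒᵖ (SymmetricQuotients Fl Fr M) :=
  @RightGabrielFilter.instModuleQuotients (Env R) _ (symmetricFilter Fl Fr) M _
    (bimoduleToRight R M)

/-- The left `R`-action `s x = x · (1 ⊗ s)`. -/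
noncomputable instance : Module R (SymmetricQuotients Fl Fr M) :=
  Module.compHom _ (envLeft R)

/-- The right `R`-action `x r = x · (r ⊗ 1)`. -/
noncomputable instance : Module Rᵐᵒᵖ (SymmetricQuotients Fl Fr M) :=
  Module.compHom _ (envRight R)

instance : SMulCommClass R Rᵐᵒᵖ (SymmetricQuotients Fl Fr M) where
  smul_comm s r x := by
    change envLeft R s • envRight R r • x = envRight R r • envLeft R s • x
    rw [← mul_smul, ← mul_smul, envLeft_commute_envRight]

/-- The canonical map `q_M` from a bimodule to its symmetric module of quotients. -/
noncomputable def toSymmetricQuotients : M →+ SymmetricQuotients Fl Fr M :=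
  (@RightGabrielFilter.toQuotients (Env R) _ (symmetricFilter Fl Fr) M _
    (bimoduleToRight R M)).toAddMonoidHom

variable {Fl Fr} in
/-- The map between symmetric modules of quotients induced by an inclusion of symmetric filters. -/
noncomputable def symmetricQuotientsMap {Fl' : LeftGabrielFilter R} {Fr' : RightGabrielFilter R}
    (h : (symmetricFilter Fl Fr).ideals ⊆ (symmetricFilter Fl' Fr').ideals) :
    SymmetricQuotients Fl Fr M →+ SymmetricQuotients Fl' Fr' M :=
  (@RightGabrielFilter.quotientsMap (Env R) _ M _ (bimoduleToRight R M) _ _ h).toAddMonoidHom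

end SymmetricQuotients

end Bimodules

/-- A higher derivation `{δ_n}` on a ring. -/
structure HigherDerivation (R : Type u) [Ring R] where
  toFun : ℕ → R →+ R
  map_zero : toFun 0 = AddMonoidHom.id R
  map_mul : ∀ n r s, toFun n (r * s) =
    ∑ p ∈ Finset.HasAntidiagonal.antidiagonal n, toFun p.1 r * toFun p.2 s

namespace HigherDerivation

variable {R : Type u} [Ring R] (Δ : HigherDerivation R)

/-- The additive map on `R ⊗ R^op` with `r ⊗ s ↦ ∑ δ_i(r) ⊗ δ_{n-i}(s)`. -/
noncomputable def env (n : ℕ) : Env R →+ Env R :=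
  ∑ p ∈ Finset.HasAntidiagonal.antidiagonal n,
    (TensorProduct.map (Δ.toFun p.1).toIntLinearMap
      (AddMonoidHom.mulOp (Δ.toFun p.2)).toIntLinearMap).toAddMonoidHom

theorem env_tmul (n : ℕ) (r s : R) : Δ.env n (r ⊗ₜ[ℤ] op s) =
    ∑ p ∈ Finset.HasAntidiagonal.antidiagonal n, Δ.toFun p.1 r ⊗ₜ[ℤ] op (Δ.toFun p.2 s) :=
  AddMonoidHom.finsetSum_apply _ _ _

end HigherDerivation

/-- A filter of right ideals of `R ⊗ R^op` is invariant under a higher derivation `Δ` of `R` if for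
every `K` in it and every `n` there is `J` in it with `δ̄_i(J) ⊆ K` for all `i ≤ n`. -/
def RightGabrielFilter.IsInvariant {R : Type u} [Ring R] (F : RightGabrielFilter (Env R))
    (Δ : HigherDerivation R) : Prop :=
  ∀ K ∈ F.ideals, ∀ n : ℕ, ∃ J ∈ F.ideals, ∀ i ≤ n, ∀ x ∈ J, Δ.env i x ∈ K

/-- A `Δ`-higher derivation `{d_n}` on an `R`-bimodule. -/
structure BimoduleHigherDerivation {R : Type u} [Ring R] (Δ : HigherDerivation R) (M : Type v)
    [AddCommGroup M] [Module R M] [Module Rᵐᵒᵖ M] where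
  toFun : ℕ → M →+ M
  map_zero : toFun 0 = AddMonoidHom.id M
  map_smul_left : ∀ n (r : R) (x : M), toFun n (r • x) =
    ∑ p ∈ Finset.HasAntidiagonal.antidiagonal n, Δ.toFun p.1 r • toFun p.2 x
  map_smul_right : ∀ n (x : M) (r : R), toFun n (op r • x) =
    ∑ p ∈ Finset.HasAntidiagonal.antidiagonal n, op (Δ.toFun p.2 r) • toFun p.1 x

namespace BimoduleHigherDerivation

variable {R : Type u} [Ring R] {Δ : HigherDerivation R} {M : Type v} [AddCommGroup M] [Module R M]
  [Module Rᵐᵒᵖ M] [SMulCommClass R Rᵐᵒᵖ M]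

/-- `D'` is an extension of `D` to the symmetric module of quotients: `d'_n q_M = q_M d_n`. -/
def IsExtension {Fl : LeftGabrielFilter R} {Fr : RightGabrielFilter R}
    (D' : BimoduleHigherDerivation Δ (SymmetricQuotients Fl Fr M))
    (D : BimoduleHigherDerivation Δ M) : Prop :=
  ∀ n (m : M), D'.toFun n (toSymmetricQuotients Fl Fr M m) =
    toSymmetricQuotients Fl Fr M (D.toFun n m)

/-- The extensions `D₁` and `D₂` of `D` agree: with `q₁`, `q₂` the canonical maps and `q₁₂` the map
induced by the inclusion of filters, all faces of the prism
`q₁₂ q₁ = q₂`, `d_n q₁ = q₁ d_n`, `d_n q₂ = q₂ d_n`, `q₁₂ d_n = d_n q₁₂` commute. -/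
structure ExtensionsAgree {Fl₁ Fl₂ : LeftGabrielFilter R} {Fr₁ Fr₂ : RightGabrielFilter R}
    (h : (symmetricFilter Fl₁ Fr₁).ideals ⊆ (symmetricFilter Fl₂ Fr₂).ideals)
    (D : BimoduleHigherDerivation Δ M)
    (D₁ : BimoduleHigherDerivation Δ (SymmetricQuotients Fl₁ Fr₁ M))
    (D₂ : BimoduleHigherDerivation Δ (SymmetricQuotients Fl₂ Fr₂ M)) : Prop where
  triangle : ∀ m : M, symmetricQuotientsMap M h (toSymmetricQuotients Fl₁ Fr₁ M m) =
    toSymmetricQuotients Fl₂ Fr₂ M m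
  extends₁ : D₁.IsExtension D
  extends₂ : D₂.IsExtension D
  square : ∀ n x, symmetricQuotientsMap M h (D₁.toFun n x) =
    D₂.toFun n (symmetricQuotientsMap M h x)

end BimoduleHigherDerivation

/-!
A higher derivation `Δ = {δ_n}` of a ring `A` is a ring homomorphism `A → A⟦t⟧`, `a ↦ ∑ δ_n(a) tⁿ`,
that is the identity modulo `t`. Through it `A` acts on the power series `X⟦t⟧` over a right module
`X`, and for this action the Leibniz rule for a family of additive maps `d_n : M → X` says precisely
that its jet `m ↦ ∑ d_n(m) tⁿ` is an `A`-linear map `M → X⟦t⟧`.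

On the graded pieces `tⁿX⟦t⟧ / tⁿ⁺¹X⟦t⟧ ≅ X` the action of `A` is the original one, so, solving for
one coefficient after the other, `X⟦t⟧` is closed for a Gabriel filter `F` as soon as `X` is. The
module of quotients `M_F` is closed and `M → M_F` is universal among maps to closed modules, so that
`M → M⟦t⟧ → M_F⟦t⟧` extends uniquely to `M_F → M_F⟦t⟧`: this is the jet of the extended higher
derivation. For `F ⊆ G` the two extensions agree because a map `M → M_G⟦t⟧` has at most one
extension to `M_F`. Bimodules over `R` are the case `A = R ⊗ R^op`.
-/

open Finset PowerSeries

theorem sum_antidiagonal_antidiagonal_assoc {N : Type*} [AddCommMonoid N] (n : ℕ)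
    (g : ℕ → ℕ → ℕ → N) :
    ∑ p ∈ antidiagonal n, ∑ q ∈ antidiagonal p.1, g q.1 q.2 p.2 =
      ∑ p ∈ antidiagonal n, ∑ q ∈ antidiagonal p.2, g p.1 q.1 q.2 := by
  rw [sum_sigma', sum_sigma']
  refine sum_nbij' (fun x => ⟨(x.2.1, x.2.2 + x.1.2), (x.2.2, x.1.2)⟩)
    (fun x => ⟨(x.1.1 + x.2.1, x.2.2), (x.1.1, x.2.1)⟩) ?_ ?_ ?_ ?_ fun _ _ => rfl <;>
  · rintro ⟨⟨a, b⟩, c, d⟩ h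
    simp only [mem_sigma, HasAntidiagonal.mem_antidiagonal] at h ⊢
    obtain ⟨rfl, rfl⟩ := h
    simp [add_assoc]

theorem sum_antidiagonal_eq_of_forall_lt {N : Type*} [AddCommMonoid N] {n : ℕ} {g : ℕ × ℕ → N}
    (h : ∀ p ∈ antidiagonal n, p.1 < n → g p = 0) : ∑ p ∈ antidiagonal n, g p = g (n, 0) := by
  refine sum_eq_single_of_mem _ (by simp) fun p hp hne => h p hp ?_
  rw [HasAntidiagonal.mem_antidiagonal] at hp
  have : p.2 ≠ 0 := fun h0 => hne (Prod.ext (by omega) h0)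
  omega

namespace HigherDerivation

variable {A : Type u} [Ring A] (Δ : HigherDerivation A)

@[simp]
theorem toFun_zero_apply (a : A) : Δ.toFun 0 a = a := by
  rw [Δ.map_zero, AddMonoidHom.id_apply]

theorem mk_toFun_mul (a b : A) : PowerSeries.mk (fun n => Δ.toFun n (a * b)) =
    PowerSeries.mk (fun n => Δ.toFun n a) * PowerSeries.mk fun n => Δ.toFun n b := by
  ext n
  simp only [coeff_mk, coeff_mul, Δ.map_mul]

/-- The Taylor map `a ↦ ∑ δ_n(a) Xⁿ`: a higher derivation is the same as a ring homomorphism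
`A → A⟦X⟧` that is the identity modulo `X`. -/
noncomputable def taylor : A →+* A⟦X⟧ where
  toFun a := PowerSeries.mk fun n => Δ.toFun n a
  map_one' := by
    -- The image of `1` is an idempotent, and it is a unit because its constant coefficient is `1`.
    refine (IsIdempotentElem.iff_eq_one_of_isUnit (isUnit_iff_constantCoeff.2 ?_)).1 ?_
    · simp [← coeff_zero_eq_constantCoeff_apply]
    · rw [IsIdempotentElem, ← mk_toFun_mul, mul_one]
  map_mul' := Δ.mk_toFun_mul
  map_zero' := by ext; simp
  map_add' a b := by ext; simp

@[simp]
theorem coeff_taylor (n : ℕ) (a : A) : coeff n (Δ.taylor a) = Δ.toFun n a :=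
  coeff_mk n fun n => Δ.toFun n a

theorem toFun_one (n : ℕ) : Δ.toFun n 1 = if n = 0 then 1 else 0 := by
  rw [← coeff_taylor, map_one, coeff_one]

/-- The right ideal of the elements whose images under `δ_0, …, δ_n` lie in the right ideal `I`. -/
def comapIdeal (I : Submodule Aᵐᵒᵖ A) (n : ℕ) : Submodule Aᵐᵒᵖ A where
  carrier := {a | ∀ i ≤ n, Δ.toFun i a ∈ I}
  add_mem' ha hb i hi := by
    rw [map_add]
    exact I.add_mem (ha i hi) (hb i hi)
  zero_mem' i _ := by
    rw [_root_.map_zero]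
    exact I.zero_mem
  smul_mem' c a ha i hi := by
    change Δ.toFun i (a * unop c) ∈ I
    rw [Δ.map_mul]
    exact I.sum_mem fun p hp => I.smul_mem (op (Δ.toFun p.2 (unop c)))
      (ha p.1 ((HasAntidiagonal.antidiagonal.fst_le hp).trans hi))

theorem comapIdeal_mem (F : RightGabrielFilter A) {I : Submodule Aᵐᵒᵖ A} (hI : I ∈ F.ideals)
    (n : ℕ) : Δ.comapIdeal I n ∈ F.ideals := by
  induction n with
  | zero =>
    refine F.mem_of_le hI fun a ha i hi => ?_
    rwa [Nat.le_zero.1 hi, toFun_zero_apply]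
  | succ n ih =>
    refine F.mem_of_residual _ ih _ fun a ha =>
      F.mem_of_le (F.residual_mem I hI (Δ.toFun (n + 1) a)) fun b hb i hi => ?_
    change Δ.toFun i (a * b) ∈ I
    rw [Δ.map_mul]
    refine I.sum_mem fun p hp => ?_
    obtain hpn | hpn := Nat.le_or_eq_of_le_succ ((HasAntidiagonal.antidiagonal.fst_le hp).trans hi)
    · exact I.smul_mem (op (Δ.toFun p.2 b)) (ha p.1 hpn)
    · have hp' := HasAntidiagonal.mem_antidiagonal.1 hp
      rw [hpn, show p.2 = 0 by omega, toFun_zero_apply]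
      exact hb

/-- The right `A`-module of sequences in a right `A`-module `X`, read as power series `X⟦t⟧` with
`A` acting through the Taylor map of `Δ`. -/
def Jets (_Δ : HigherDerivation A) (X : Type*) : Type _ := ℕ → X

namespace Jets

variable {Δ} {X : Type*}

@[ext]
theorem ext {y z : Δ.Jets X} (h : ∀ n, y n = z n) : y = z := funext h

variable [AddCommGroup X]

instance : AddCommGroup (Δ.Jets X) := inferInstanceAs (AddCommGroup (ℕ → X))

@[simp]
theorem zero_apply (n : ℕ) : (0 : Δ.Jets X) n = 0 := rfl

@[simp]
theorem add_apply (y z : Δ.Jets X) (n : ℕ) : (y + z) n = y n + z n := rfl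

@[simp]
theorem sub_apply (y z : Δ.Jets X) (n : ℕ) : (y - z) n = y n - z n := rfl

/-- The jet `z tⁿ`. -/
def monomial (n : ℕ) (z : X) : Δ.Jets X := Pi.single n z

@[simp]
theorem monomial_apply_self (n : ℕ) (z : X) : (monomial n z : Δ.Jets X) n = z :=
  Pi.single_eq_same (M := fun _ => X) n z

variable [Module Aᵐᵒᵖ X]

instance : SMul Aᵐᵒᵖ (Δ.Jets X) where
  smul c y n := ∑ p ∈ antidiagonal n, op (Δ.toFun p.2 (unop c)) • y p.1

theorem smul_apply (c : Aᵐᵒᵖ) (y : Δ.Jets X) (n : ℕ) :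
    (c • y) n = ∑ p ∈ antidiagonal n, op (Δ.toFun p.2 (unop c)) • y p.1 := rfl

instance : Module Aᵐᵒᵖ (Δ.Jets X) where
  one_smul y := by
    ext n
    have vanish : ∀ p ∈ antidiagonal n, p.1 < n → op (Δ.toFun p.2 1) • y p.1 = 0 := by
      intro p hp hpn
      rw [HasAntidiagonal.mem_antidiagonal] at hp
      rw [toFun_one, if_neg (by omega), op_zero, zero_smul]
    rw [smul_apply, unop_one, sum_antidiagonal_eq_of_forall_lt vanish, toFun_zero_apply, op_one,
      one_smul]
  mul_smul c d y := by
    ext n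
    simp only [smul_apply, unop_mul, Δ.map_mul, op_sum, op_mul, sum_smul, smul_sum, mul_smul]
    exact (sum_antidiagonal_antidiagonal_assoc n fun i j k =>
      op (Δ.toFun k (unop c)) • op (Δ.toFun j (unop d)) • y i).symm
  smul_zero c := by ext; simp [smul_apply]
  smul_add c y z := by ext; simp [smul_apply, sum_add_distrib]
  add_smul c d y := by ext; simp [smul_apply, add_smul, sum_add_distrib]
  zero_smul y := by ext; simp [smul_apply]

/-- Jets are functorial in the module. -/
def map {Y : Type*} [AddCommGroup Y] [Module Aᵐᵒᵖ Y] (f : X →ₗ[Aᵐᵒᵖ] Y) :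
    Δ.Jets X →ₗ[Aᵐᵒᵖ] Δ.Jets Y where
  toFun y n := f (y n)
  map_add' y z := funext fun n => map_add f (y n) (z n)
  map_smul' _ _ := funext fun _ => (map_sum f _ _).trans (sum_congr rfl fun _ _ => map_smul f _ _)

@[simp]
theorem map_apply {Y : Type*} [AddCommGroup Y] [Module Aᵐᵒᵖ Y] (f : X →ₗ[Aᵐᵒᵖ] Y)
    (y : Δ.Jets X) (n : ℕ) : map f y n = f (y n) := rfl

theorem smul_apply_of_forall_lt {n : ℕ} {y : Δ.Jets X} (hy : ∀ k < n, y k = 0) (c : Aᵐᵒᵖ) :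
    (c • y) n = c • y n := by
  rw [smul_apply, sum_antidiagonal_eq_of_forall_lt fun p _ hp => by rw [hy _ hp, smul_zero],
    toFun_zero_apply, op_unop]

variable (Δ X) in
/-- The submodule `tⁿX⟦t⟧` of the jets that vanish to order `n`. -/
def vanishing (n : ℕ) : Submodule Aᵐᵒᵖ (Δ.Jets X) where
  carrier := {y | ∀ k < n, y k = 0}
  add_mem' hy hz k hk := by rw [add_apply, hy k hk, hz k hk, add_zero]
  zero_mem' _ _ := rfl
  smul_mem' c y hy k hk := by
    rw [smul_apply_of_forall_lt (fun j hj => hy j (hj.trans hk)), hy k hk, smul_zero]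

theorem mem_vanishing_succ {n : ℕ} {y : Δ.Jets X} :
    y ∈ vanishing Δ X (n + 1) ↔ y ∈ vanishing Δ X n ∧ y n = 0 :=
  Nat.forall_lt_succ_right

theorem eq_zero_of_forall_mem_vanishing {y : Δ.Jets X} (h : ∀ n, y ∈ vanishing Δ X n) : y = 0 :=
  ext fun n => h (n + 1) n n.lt_succ_self

variable (Δ X) in
/-- The coefficient of `tⁿ` is linear on `tⁿX⟦t⟧`, where the action of `A` on leading coefficients
is not twisted by `Δ`. -/
def leadingCoeff (n : ℕ) : vanishing Δ X n →ₗ[Aᵐᵒᵖ] X where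
  toFun y := y.1 n
  map_add' _ _ := rfl
  map_smul' c y := smul_apply_of_forall_lt y.2 c

variable (Δ X) in
/-- The constant coefficient of a jet. -/
def constantCoeff : Δ.Jets X →ₗ[Aᵐᵒᵖ] X where
  toFun y := y 0
  map_add' _ _ := rfl
  map_smul' c _ := smul_apply_of_forall_lt (fun _ hk => absurd hk (Nat.not_lt_zero _)) c

theorem monomial_mem_vanishing (n : ℕ) (z : X) : monomial n z ∈ vanishing Δ X n :=
  fun _ hk => Pi.single_eq_of_ne (M := fun _ => X) hk.ne z

end Jets
end HigherDerivation

namespace RightGabrielFilter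

variable {A : Type u} [Ring A] (F : RightGabrielFilter A)

section ClosedModules

variable (X : Type*) [AddCommGroup X] [Module Aᵐᵒᵖ X]

/-- A right module is `F`-torsion-free if no nonzero element is annihilated by an ideal of `F`. -/
def IsTorsionFree : Prop :=
  ∀ I ∈ F.ideals, ∀ y : X, (∀ a ∈ I, op a • y = 0) → y = 0

/-- A right module `X` is `F`-closed if every homomorphism to `X` from an ideal `I` of `F` extends
uniquely to the ring, that is, `X → Hom(I, X)` is bijective. -/
structure IsClosed : Prop where
  isTorsionFree : F.IsTorsionFree X
  exists_smul_eq : ∀ I ∈ F.ideals, ∀ f : I →ₗ[Aᵐᵒᵖ] X, ∃ y : X, ∀ a : I, op a.1 • y = f a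

end ClosedModules

/-- The homomorphism `A → X`, `a ↦ y · a`. -/
def orbitMap {X : Type*} [AddCommGroup X] [Module Aᵐᵒᵖ X] (y : X) : A →ₗ[Aᵐᵒᵖ] X where
  toFun a := op a • y
  map_add' a b := add_smul (op a) (op b) y
  map_smul' c a := mul_smul c (op a) y

variable {F}

section ClosedModules

variable {X : Type*} [AddCommGroup X] [Module Aᵐᵒᵖ X]

theorem IsTorsionFree.eq_of_smul_eq (hX : F.IsTorsionFree X) {I : Submodule Aᵐᵒᵖ A}
    (hI : I ∈ F.ideals) {y z : X} (h : ∀ a ∈ I, op a • y = op a • z) : y = z :=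
  sub_eq_zero.1 <| hX I hI _ fun a ha => by rw [smul_sub, h a ha, sub_self]

theorem IsTorsionFree.mono {G : RightGabrielFilter A} (hX : G.IsTorsionFree X)
    (h : F.ideals ⊆ G.ideals) : F.IsTorsionFree X := fun I hI => hX I (h hI)

namespace IsClosed

/-- The element `y` of a closed module `X` that represents a homomorphism `a ↦ y · a` from an ideal
of the filter to `X`. -/
noncomputable def elemOfHom (hX : F.IsClosed X) (i : F.Index) (f : F.idealOf i →ₗ[Aᵐᵒᵖ] X) : X :=
  (hX.exists_smul_eq (F.idealOf i) i.2 f).choose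

theorem smul_elemOfHom (hX : F.IsClosed X) (i : F.Index) (f : F.idealOf i →ₗ[Aᵐᵒᵖ] X)
    (a : F.idealOf i) : op a.1 • hX.elemOfHom i f = f a :=
  (hX.exists_smul_eq (F.idealOf i) i.2 f).choose_spec a

theorem elemOfHom_eq (hX : F.IsClosed X) {i j : F.Index} (hij : i ≤ j) {y : X}
    {f : F.idealOf i →ₗ[Aᵐᵒᵖ] X} (h : ∀ a (ha : a ∈ F.idealOf j), f ⟨a, hij ha⟩ = op a • y) :
    hX.elemOfHom i f = y :=
  hX.isTorsionFree.eq_of_smul_eq j.2 fun a ha => by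
    rw [← h a ha, ← hX.smul_elemOfHom i f]

end IsClosed

end ClosedModules

section Jets

open HigherDerivation Jets

variable {Δ : HigherDerivation A} {X : Type*} [AddCommGroup X] [Module Aᵐᵒᵖ X]

theorem IsTorsionFree.mem_vanishing_of_smul_mem (hX : F.IsTorsionFree X) {I : Submodule Aᵐᵒᵖ A}
    (hI : I ∈ F.ideals) {n : ℕ} {y : Δ.Jets X} (h : ∀ a ∈ I, op a • y ∈ vanishing Δ X n) :
    y ∈ vanishing Δ X n := by
  induction n with
  | zero => exact fun k hk => absurd hk (Nat.not_lt_zero k)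
  | succ n ih =>
    have hy : y ∈ vanishing Δ X n := ih fun a ha => (mem_vanishing_succ.1 (h a ha)).1
    refine mem_vanishing_succ.2 ⟨hy, hX I hI _ fun a ha => ?_⟩
    rw [← smul_apply_of_forall_lt hy, (mem_vanishing_succ.1 (h a ha)).2]

theorem IsTorsionFree.jets (hX : F.IsTorsionFree X) : F.IsTorsionFree (Δ.Jets X) :=
  fun I hI y hy => eq_zero_of_forall_mem_vanishing fun n =>
    hX.mem_vanishing_of_smul_mem hI fun a ha => by rw [hy a ha]; exact zero_mem _

theorem IsClosed.exists_sub_mem_vanishing (hX : F.IsClosed X) {I : Submodule Aᵐᵒᵖ A}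
    (hI : I ∈ F.ideals) (f : I →ₗ[Aᵐᵒᵖ] Δ.Jets X) (n : ℕ) :
    ∃ y : Δ.Jets X, ∀ a : I, f a - op a.1 • y ∈ vanishing Δ X n := by
  induction n with
  | zero => exact ⟨0, fun a k hk => absurd hk (Nat.not_lt_zero k)⟩
  | succ n ih =>
    obtain ⟨y, hy⟩ := ih
    let error : I →ₗ[Aᵐᵒᵖ] vanishing Δ X n :=
      (f - (orbitMap y).domRestrict I).codRestrict _ hy
    obtain ⟨z, hz⟩ := hX.exists_smul_eq I hI (leadingCoeff Δ X n ∘ₗ error)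
    have hz' (a : I) : op a.1 • z = (f a - op a.1 • y) n := hz a
    refine ⟨y + monomial n z, fun a => mem_vanishing_succ.2 ?_⟩
    rw [smul_add, ← sub_sub]
    refine ⟨sub_mem (hy a) (Submodule.smul_mem _ _ (monomial_mem_vanishing n z)), ?_⟩
    rw [Jets.sub_apply, smul_apply_of_forall_lt (monomial_mem_vanishing n z), monomial_apply_self,
      hz', sub_self]

theorem IsClosed.jets (hX : F.IsClosed X) : F.IsClosed (Δ.Jets X) where
  isTorsionFree := hX.isTorsionFree.jets
  exists_smul_eq I hI f := by
    choose y hy using hX.exists_sub_mem_vanishing hI f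
    have coherent {n m : ℕ} (hnm : n ≤ m) : y m - y n ∈ vanishing Δ X n := by
      refine hX.isTorsionFree.mem_vanishing_of_smul_mem hI fun a ha => ?_
      have hm : f ⟨a, ha⟩ - op a • y m ∈ vanishing Δ X n :=
        fun k hk => hy m ⟨a, ha⟩ k (hk.trans_le hnm)
      rw [smul_sub, ← sub_sub_sub_cancel_left _ _ (f ⟨a, ha⟩)]
      exact sub_mem (hy n ⟨a, ha⟩) hm
    let limit : Δ.Jets X := fun n => y (n + 1) n
    have limit_sub_mem (n : ℕ) : limit - y n ∈ vanishing Δ X n := fun k hk => by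
      rw [Jets.sub_apply, sub_eq_zero]
      exact (sub_eq_zero.1 (coherent (Nat.succ_le_of_lt hk) k k.lt_succ_self)).symm
    refine ⟨limit, fun a => sub_eq_zero.1 (eq_zero_of_forall_mem_vanishing fun n => ?_)⟩
    rw [← sub_sub_sub_cancel_right _ _ (op a.1 • y n), ← smul_sub]
    exact sub_mem (Submodule.smul_mem _ _ (limit_sub_mem n)) (hy n a)

end Jets

section ModuleOfQuotients

variable {A : Type u} [Ring A] (F : RightGabrielFilter A)
variable {M : Type v} [AddCommGroup M] [Module Aᵐᵒᵖ M]

variable (M) in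
theorem isTorsionFree_quotient_torsion : F.IsTorsionFree (M ⧸ F.torsion M) := by
  intro I hI x hx
  obtain ⟨m, rfl⟩ := (F.torsion M).mkQ_surjective x
  refine (Submodule.Quotient.mk_eq_zero _).2 (F.mem_of_residual I hI _ fun a ha => ?_)
  have ham : op a • m ∈ F.torsion M := (Submodule.Quotient.mk_eq_zero _).1 (hx a ha)
  refine F.mem_of_le ham fun b hb => ?_
  change op (a * b) • m = 0
  rw [op_mul, mul_smul]
  exact hb

variable {F} in
theorem ofHom_eq_zero_iff {i : F.Index} {f : F.HomOn M i} : F.ofHom i f = 0 ↔ f = 0 := by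
  have ofHom_zero : F.ofHom i 0 = (0 : F.ModuleOfQuotients M) :=
    (DirectLimit.zero_def (f := F.restrict M) i).symm
  refine ⟨fun h => ?_, fun h => h ▸ ofHom_zero⟩
  rw [← ofHom_zero] at h
  obtain ⟨k, hik, _, hk⟩ := Quotient.exact h
  refine LinearMap.ext fun a => F.isTorsionFree_quotient_torsion M _
    (F.residual_mem _ k.2 a.1) _ fun b hb => ?_
  rw [← map_smul]
  exact LinearMap.congr_fun hk ⟨a * b, hb⟩

variable (M) in
/-- The map `M/t(M) → M_F` induced by the canonical map. -/
noncomputable def quotientToQuotients : (M ⧸ F.torsion M) →ₗ[Aᵐᵒᵖ] F.ModuleOfQuotients M :=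
  (F.torsion M).liftQ (F.toQuotients M) fun m hm => ofHom_eq_zero_iff.2 <| LinearMap.ext fun a => by
    change op a.1 • (F.torsion M).mkQ m = 0
    rw [Submodule.mkQ_apply, (Submodule.Quotient.mk_eq_zero _).2 hm, smul_zero]

theorem quotientToQuotients_mk (m : M) :
    F.quotientToQuotients M (Submodule.Quotient.mk m) = F.toQuotients M m := rfl

variable (M) in
theorem quotientToQuotients_injective : Function.Injective (F.quotientToQuotients M) := by
  refine (injective_iff_map_eq_zero _).2 fun x hx => ?_
  obtain ⟨m, rfl⟩ := (F.torsion M).mkQ_surjective x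
  have h : op (1 : A) • (F.torsion M).mkQ m = 0 :=
    LinearMap.congr_fun (ofHom_eq_zero_iff.1 hx) ⟨1, trivial⟩
  rwa [op_one, one_smul] at h

theorem smul_ofHom_eq_quotientToQuotients (i : F.Index) (f : F.HomOn M i) (a : F.idealOf i) :
    op a.1 • F.ofHom i f = F.quotientToQuotients M (f a) := by
  obtain ⟨m, hm⟩ := (F.torsion M).mkQ_surjective (f a)
  rw [smul_ofHom, ← hm, Submodule.mkQ_apply, quotientToQuotients_mk]
  refine F.ofHom_eq_ofHom (F.index _ (F.residual_mem _ i.2 a.1)) le_rfl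
    (index_le (i := F.index ⊤ F.top_mem) le_top) fun b hb => ?_
  change f ⟨a * b, _⟩ = op b • (F.torsion M).mkQ m
  rw [hm, ← map_smul]
  rfl

variable (M) in
theorem isTorsionFree_moduleOfQuotients : F.IsTorsionFree (F.ModuleOfQuotients M) := by
  intro I hI x hx
  obtain ⟨i, f, rfl⟩ := F.ofHom_surj x
  rw [← ofHom_eq_zero_iff (i := i).2 rfl]
  refine F.ofHom_eq_ofHom (F.index _ (F.inf_mem i.2 hI)) (index_le inf_le_left)
    (index_le inf_le_left) fun a ha => F.quotientToQuotients_injective M ?_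
  rw [← smul_ofHom_eq_quotientToQuotients, hx a ha.2, LinearMap.zero_apply, map_zero]

theorem rightResidual_range_mem (x : F.ModuleOfQuotients M) :
    rightResidual x (F.quotientToQuotients M).range ∈ F.ideals := by
  obtain ⟨i, f, rfl⟩ := F.ofHom_surj x
  refine F.mem_of_le i.2 fun a ha => ?_
  exact ⟨f ⟨a, ha⟩, (F.smul_ofHom_eq_quotientToQuotients i f ⟨a, ha⟩).symm⟩

theorem exists_lift_mem_ideals {I : Submodule Aᵐᵒᵖ A} (hI : I ∈ F.ideals)
    (f : I →ₗ[Aᵐᵒᵖ] F.ModuleOfQuotients M) :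
    ∃ (j : F.Index) (hj : F.idealOf j ≤ I) (g : F.HomOn M j),
      ∀ a : F.idealOf j, F.quotientToQuotients M (g a) = f ⟨a, hj a.2⟩ := by
  let K := ((F.quotientToQuotients M).range.comap f).map I.subtype
  have hKI : K ≤ I := Submodule.map_subtype_le _ _
  have hK : K ∈ F.ideals := F.mem_of_residual I hI _ fun a ha =>
    F.mem_of_le (F.rightResidual_range_mem (f ⟨a, ha⟩)) fun b hb =>
      ⟨op b • ⟨a, ha⟩, by rwa [SetLike.mem_coe, Submodule.mem_comap, map_smul], rfl⟩
  have f_mem (a : K) : f ⟨a, hKI a.2⟩ ∈ (F.quotientToQuotients M).range := by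
    obtain ⟨_, c, hc, rfl⟩ := a
    exact hc
  let ι := LinearEquiv.ofInjective _ (F.quotientToQuotients_injective M)
  refine ⟨F.index K hK, hKI,
    ι.symm ∘ₗ (f ∘ₗ Submodule.inclusion hKI).codRestrict _ f_mem, fun a => ?_⟩
  exact congrArg Subtype.val (ι.apply_symm_apply ⟨_, f_mem a⟩)

variable (M) in
theorem isClosed_moduleOfQuotients : F.IsClosed (F.ModuleOfQuotients M) where
  isTorsionFree := F.isTorsionFree_moduleOfQuotients M
  exists_smul_eq I hI f := by
    obtain ⟨j, hj, g, hg⟩ := F.exists_lift_mem_ideals hI f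
    refine ⟨F.ofHom j g, fun a => (F.isTorsionFree_moduleOfQuotients M).eq_of_smul_eq
      (F.residual_mem _ j.2 a.1) fun b hb => ?_⟩
    rw [← mul_smul, ← op_mul, F.smul_ofHom_eq_quotientToQuotients j g ⟨a * b, hb⟩, hg, ← map_smul]
    rfl

end ModuleOfQuotients

section UniversalProperty

variable {A : Type u} [Ring A] {F : RightGabrielFilter A}
variable {M : Type v} [AddCommGroup M] [Module Aᵐᵒᵖ M]
variable {X : Type*} [AddCommGroup X] [Module Aᵐᵒᵖ X]

theorem IsTorsionFree.hom_ext (hX : F.IsTorsionFree X) {β γ : F.ModuleOfQuotients M →ₗ[Aᵐᵒᵖ] X}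
    (h : ∀ m, β (F.toQuotients M m) = γ (F.toQuotients M m)) : β = γ := by
  refine LinearMap.ext fun x => hX.eq_of_smul_eq (F.rightResidual_range_mem x) ?_
  rintro a ⟨y, hy⟩
  obtain ⟨m, rfl⟩ := (F.torsion M).mkQ_surjective y
  rw [← map_smul, ← map_smul, ← hy]
  exact h m

theorem quotientsMap_toQuotients {G : RightGabrielFilter A} (h : F.ideals ⊆ G.ideals) (m : M) :
    quotientsMap M h (F.toQuotients M m) = G.toQuotients M m := rfl

theorem IsTorsionFree.torsion_le_ker (hX : F.IsTorsionFree X) (α : M →ₗ[Aᵐᵒᵖ] X) :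
    F.torsion M ≤ α.ker := fun m hm => hX _ hm _ fun a ha => by
  rw [← map_smul, (show op a • m = 0 from ha), map_zero]

namespace IsClosed

variable (hX : F.IsClosed X) (α : M →ₗ[Aᵐᵒᵖ] X)

/-- The extension to `M_F` of a homomorphism from `M` to an `F`-closed module. -/
noncomputable def lift : F.ModuleOfQuotients M →ₗ[Aᵐᵒᵖ] X :=
  let α' : (M ⧸ F.torsion M) →ₗ[Aᵐᵒᵖ] X :=
    (F.torsion M).liftQ α (hX.isTorsionFree.torsion_le_ker α)
  { toFun := DirectLimit.lift (F.restrict M) (fun i f => hX.elemOfHom i (α' ∘ₗ f))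
      fun i j hij f => hX.elemOfHom_eq hij fun a ha =>
        (hX.smul_elemOfHom j (α' ∘ₗ F.restrict M i j hij f) ⟨a, ha⟩).symm
    map_add' x y := by
      obtain ⟨i, f, g, rfl, rfl⟩ := F.ofHom_surj₂ x y
      rw [← ofHom_add]
      refine hX.elemOfHom_eq le_rfl fun a ha => ?_
      have hf := hX.smul_elemOfHom i (α' ∘ₗ f) ⟨a, ha⟩
      have hg := hX.smul_elemOfHom i (α' ∘ₗ g) ⟨a, ha⟩
      rw [LinearMap.comp_add, LinearMap.add_apply, ← hf, ← hg, ← smul_add]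
      rfl
    map_smul' c x := by
      obtain ⟨i, f, rfl⟩ := F.ofHom_surj x
      refine hX.elemOfHom_eq le_rfl fun a ha => ?_
      exact (hX.smul_elemOfHom i (α' ∘ₗ f) ⟨unop c * a, ha⟩).symm.trans (mul_smul (op a) c _) }

theorem lift_toQuotients (m : M) : hX.lift α (F.toQuotients M m) = α m :=
  hX.elemOfHom_eq le_rfl fun a _ => map_smul α (op a) m

end IsClosed
end UniversalProperty
end RightGabrielFilter

/-- A `Δ`-higher derivation `{d_n}` on a right module over a ring with a higher derivation `Δ`. -/
@[ext]
structure RightHigherDerivation {A : Type u} [Ring A] (Δ : HigherDerivation A) (M : Type v)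
    [AddCommGroup M] [Module Aᵐᵒᵖ M] where
  toFun : ℕ → M →+ M
  map_zero : toFun 0 = AddMonoidHom.id M
  map_smul : ∀ n (a : A) (x : M), toFun n (op a • x) =
    ∑ p ∈ antidiagonal n, op (Δ.toFun p.2 a) • toFun p.1 x

namespace RightHigherDerivation

open HigherDerivation RightGabrielFilter

variable {A : Type u} [Ring A] {Δ : HigherDerivation A}
variable {M : Type v} [AddCommGroup M] [Module Aᵐᵒᵖ M]

/-- The jet `m ↦ ∑ d_n(m) tⁿ` of a higher derivation; the Leibniz rule says that it is linear. -/
def jet (D : RightHigherDerivation Δ M) : M →ₗ[Aᵐᵒᵖ] Δ.Jets M where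
  toFun m n := D.toFun n m
  map_add' x y := funext fun n => map_add (D.toFun n) x y
  map_smul' c x := funext fun n => D.map_smul n (unop c) x

@[simp]
theorem jet_apply (D : RightHigherDerivation Δ M) (m : M) (n : ℕ) : D.jet m n = D.toFun n m := rfl

theorem jet_injective : Function.Injective (jet : RightHigherDerivation Δ M → _) := fun _ _ h =>
  RightHigherDerivation.ext <| funext fun n => AddMonoidHom.ext fun m =>
    congrFun (LinearMap.congr_fun h m) n

/-- The higher derivation whose jet is a given linear section of the constant coefficient. -/
def ofJet (s : M →ₗ[Aᵐᵒᵖ] Δ.Jets M) (hs : Jets.constantCoeff Δ M ∘ₗ s = LinearMap.id) :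
    RightHigherDerivation Δ M where
  toFun n :=
    { toFun := fun m => s m n
      map_zero' := congrFun (s.map_zero) n
      map_add' := fun x y => congrFun (s.map_add x y) n }
  map_zero := AddMonoidHom.ext (LinearMap.congr_fun hs)
  map_smul n a x := congrFun (s.map_smul (op a) x) n

variable {F G : RightGabrielFilter A} {D : RightHigherDerivation Δ M}

/-- `D'` is an extension of `D` to the module of quotients: `d'_n q_M = q_M d_n`. -/
def IsExtension (D' : RightHigherDerivation Δ (F.ModuleOfQuotients M))
    (D : RightHigherDerivation Δ M) : Prop :=
  ∀ n m, D'.toFun n (F.toQuotients M m) = F.toQuotients M (D.toFun n m)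

variable (F D) in
/-- The extension of a higher derivation to the module of quotients. -/
noncomputable def extend : RightHigherDerivation Δ (F.ModuleOfQuotients M) :=
  ofJet ((F.isClosed_moduleOfQuotients M).jets.lift (Jets.map (F.toQuotients M) ∘ₗ D.jet)) <|
    (F.isTorsionFree_moduleOfQuotients M).hom_ext fun m => by
      rw [LinearMap.comp_apply, IsClosed.lift_toQuotients]
      exact congrArg (F.toQuotients M) (DFunLike.congr_fun D.map_zero m)

variable (F D) in
theorem extend_isExtension : (extend F D).IsExtension D := fun n m =>
  congrFun ((F.isClosed_moduleOfQuotients M).jets.lift_toQuotients _ m) n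

theorem IsExtension.unique {D₁ D₂ : RightHigherDerivation Δ (F.ModuleOfQuotients M)}
    (h₁ : D₁.IsExtension D) (h₂ : D₂.IsExtension D) : D₁ = D₂ :=
  jet_injective <| (F.isTorsionFree_moduleOfQuotients M).jets.hom_ext fun m => by
    ext n
    rw [jet_apply, jet_apply, h₁, h₂]

theorem IsExtension.quotientsMap_toFun (h : F.ideals ⊆ G.ideals)
    {D₁ : RightHigherDerivation Δ (F.ModuleOfQuotients M)}
    {D₂ : RightHigherDerivation Δ (G.ModuleOfQuotients M)}
    (h₁ : D₁.IsExtension D) (h₂ : D₂.IsExtension D) (n : ℕ) (x : F.ModuleOfQuotients M) :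
    quotientsMap M h (D₁.toFun n x) = D₂.toFun n (quotientsMap M h x) := by
  have torsionFree : F.IsTorsionFree (Δ.Jets (G.ModuleOfQuotients M)) :=
    (G.isTorsionFree_moduleOfQuotients M).jets.mono h
  have jets_eq : Jets.map (quotientsMap M h) ∘ₗ D₁.jet = D₂.jet ∘ₗ quotientsMap M h := by
    refine torsionFree.hom_ext fun m => Jets.ext fun n => ?_
    rw [LinearMap.comp_apply, LinearMap.comp_apply, Jets.map_apply, jet_apply, jet_apply, h₁,
      quotientsMap_toQuotients, quotientsMap_toQuotients, h₂]
  exact congrFun (LinearMap.congr_fun jets_eq x) n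

end RightHigherDerivation

namespace HigherDerivation

variable {R : Type u} [Ring R] (Δ : HigherDerivation R)

/-- The higher derivation `{δ_n}` of `R`, as a higher derivation of the opposite ring. -/
def mulOpposite : HigherDerivation Rᵐᵒᵖ where
  toFun n := (Δ.toFun n).mulOp
  map_zero := by rw [Δ.map_zero]; rfl
  map_mul n r s := by
    refine (congrArg op (Δ.map_mul n (unop s) (unop r))).trans ?_
    rw [op_sum, ← Nat.sum_antidiagonal_swap]
    rfl

/-- The homomorphism `R ⊗ R^op → (R ⊗ R^op)⟦X⟧` induced by the Taylor maps of `R` and `R^op`; its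
coefficients are the maps `δ̄_n`. -/
noncomputable def envTaylor : Env R →+* (Env R)⟦X⟧ :=
  letI : Algebra ℤ (Env R)⟦X⟧ := Ring.toIntAlgebra _
  (Algebra.TensorProduct.lift
    ((PowerSeries.map Algebra.TensorProduct.includeLeftRingHom).comp Δ.taylor).toIntAlgHom
    ((PowerSeries.map (Algebra.TensorProduct.includeRight : Rᵐᵒᵖ →ₐ[ℤ] Env R).toRingHom).comp
      Δ.mulOpposite.taylor).toIntAlgHom
    fun r s => by
      refine PowerSeries.ext fun n => ?_
      rw [coeff_mul, coeff_mul, ← Nat.sum_antidiagonal_swap]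
      refine sum_congr rfl fun p _ => ?_
      simp).toRingHom

theorem coeff_envTaylor (n : ℕ) (x : Env R) : coeff n (Δ.envTaylor x) = Δ.env n x := by
  induction x using TensorProduct.induction_on with
  | zero => simp
  | add x y hx hy => rw [map_add, map_add, map_add, hx, hy]
  | tmul r s =>
    rw [← op_unop s, env_tmul]
    refine (coeff_mul n _ _).trans (sum_congr rfl fun p _ => ?_)
    simp [mulOpposite]

/-- The higher derivation of `R ⊗ R^op` induced by a higher derivation of `R`. -/
noncomputable def enveloping : HigherDerivation (Env R) where
  toFun := Δ.env
  map_zero := by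
    rw [env, HasAntidiagonal.antidiagonal_zero, sum_singleton, Δ.map_zero]
    exact congrArg LinearMap.toAddMonoidHom TensorProduct.map_id
  map_mul n x y := by
    simp only [← coeff_envTaylor, _root_.map_mul, coeff_mul]

theorem env_tmul_one (n : ℕ) (r : R) : Δ.env n (r ⊗ₜ[ℤ] 1) = Δ.toFun n r ⊗ₜ[ℤ] 1 := by
  have vanish : ∀ p ∈ antidiagonal n, p.1 < n →
      Δ.toFun p.1 r ⊗ₜ[ℤ] op (Δ.toFun p.2 1) = 0 := fun p hp hpn => by
    rw [HasAntidiagonal.mem_antidiagonal] at hp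
    rw [toFun_one, if_neg (by omega), op_zero, tmul_zero]
  rw [← op_one, env_tmul, sum_antidiagonal_eq_of_forall_lt vanish, toFun_zero_apply]

theorem env_one_tmul (n : ℕ) (s : R) : Δ.env n (1 ⊗ₜ[ℤ] op s) = 1 ⊗ₜ[ℤ] op (Δ.toFun n s) := by
  have vanish : ∀ p ∈ antidiagonal n, p.1 < n →
      Δ.toFun p.2 1 ⊗ₜ[ℤ] op (Δ.toFun p.1 s) = 0 := fun p hp hpn => by
    rw [HasAntidiagonal.mem_antidiagonal] at hp
    rw [toFun_one, if_neg (by omega), zero_tmul]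
  rw [env_tmul, ← Nat.sum_antidiagonal_swap]
  exact (sum_antidiagonal_eq_of_forall_lt vanish).trans (by rw [toFun_zero_apply])

end HigherDerivation

namespace BimoduleHigherDerivation

variable {R : Type u} [Ring R] {Δ : HigherDerivation R}
variable {M : Type v} [AddCommGroup M] [Module R M] [Module Rᵐᵒᵖ M] [Module (Env R)ᵐᵒᵖ M]

theorem map_op_smul (hM : ∀ (r s : R) (m : M), op (r ⊗ₜ[ℤ] op s) • m = s • op r • m)
    (D : BimoduleHigherDerivation Δ M) (n : ℕ) (x : Env R) (m : M) :
    D.toFun n (op x • m) = ∑ p ∈ antidiagonal n, op (Δ.env p.2 x) • D.toFun p.1 m := by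
  induction x using TensorProduct.induction_on with
  | zero =>
    have op_zero_smul (y : M) : op (0 : Env R) • y = 0 := zero_smul (Env R)ᵐᵒᵖ y
    simp only [op_zero_smul, _root_.map_zero, sum_const_zero]
  | add x y hx hy =>
    simp only [op_add, add_smul, map_add, hx, hy, sum_add_distrib]
  | tmul r s =>
    obtain ⟨s, rfl⟩ := op_surjective s
    simp only [hM, D.map_smul_left, D.map_smul_right, Δ.env_tmul, op_sum, sum_smul, smul_sum]
    rw [← sum_antidiagonal_antidiagonal_assoc n fun i j k =>
      Δ.toFun k s • op (Δ.toFun j r) • D.toFun i m, ← Nat.sum_antidiagonal_swap]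
    rfl

/-- If the right action of `R ⊗ R^op` on `M` is the one given by a bimodule structure, then the
higher derivations of the bimodule are those of the right module. -/
def equivRight (hM : ∀ (r s : R) (m : M), op (r ⊗ₜ[ℤ] op s) • m = s • op r • m) :
    BimoduleHigherDerivation Δ M ≃ RightHigherDerivation Δ.enveloping M where
  toFun D := ⟨D.toFun, D.map_zero, D.map_op_smul hM⟩
  invFun D :=
    { toFun := D.toFun
      map_zero := D.map_zero
      map_smul_left := fun n r x => by
        have hr (r : R) (x : M) : op ((1 : R) ⊗ₜ[ℤ] op r) • x = r • x := by
          rw [hM, op_one, one_smul]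
        rw [← hr, D.map_smul, ← Nat.sum_antidiagonal_swap]
        exact sum_congr rfl fun p _ => by rw [← hr, ← Δ.env_one_tmul]; rfl
      map_smul_right := fun n x r => by
        have hr (r : R) (x : M) : op (r ⊗ₜ[ℤ] (1 : Rᵐᵒᵖ)) • x = op r • x := by
          rw [← op_one, hM, one_smul]
        rw [← hr, D.map_smul]
        exact sum_congr rfl fun p _ => by rw [← hr, ← Δ.env_tmul_one]; rfl }
  left_inv _ := rfl
  right_inv _ := rfl

end BimoduleHigherDerivation

theorem SymmetricQuotients.op_tmul_smul {R : Type u} [Ring R] {Fl : LeftGabrielFilter R}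
    {Fr : RightGabrielFilter R} {M : Type v} [AddCommGroup M] [Module R M] [Module Rᵐᵒᵖ M]
    [SMulCommClass R Rᵐᵒᵖ M] (r s : R) (x : SymmetricQuotients Fl Fr M) :
    op (r ⊗ₜ[ℤ] op s) • x = s • op r • x := by
  change op (r ⊗ₜ[ℤ] op s) • x = envLeft R s • envRight R (op r) • x
  rw [← mul_smul, envLeft_apply, envRight_op, ← op_mul, Algebra.TensorProduct.tmul_mul_tmul,
    mul_one, one_mul]

theorem mainTheorem5_general {A : Type u} [Ring A] :
    (∀ (F : RightGabrielFilter A) (Δ : HigherDerivation A), ∀ K ∈ F.ideals, ∀ n : ℕ,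
      ∃ J ∈ F.ideals, ∀ i ≤ n, ∀ x ∈ J, Δ.toFun i x ∈ K) ∧
    (∀ (F : RightGabrielFilter A) (Δ : HigherDerivation A) (M : Type v) [AddCommGroup M]
      [Module Aᵐᵒᵖ M] (D : RightHigherDerivation Δ M),
      ∃! D' : RightHigherDerivation Δ (F.ModuleOfQuotients M), D'.IsExtension D) ∧
    (∀ (F G : RightGabrielFilter A) (h : F.ideals ⊆ G.ideals) (Δ : HigherDerivation A)
      (M : Type v) [AddCommGroup M] [Module Aᵐᵒᵖ M] (D : RightHigherDerivation Δ M)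
      (D₁ : RightHigherDerivation Δ (F.ModuleOfQuotients M))
      (D₂ : RightHigherDerivation Δ (G.ModuleOfQuotients M)),
      D₁.IsExtension D → D₂.IsExtension D →
        (∀ m, RightGabrielFilter.quotientsMap M h (F.toQuotients M m) = G.toQuotients M m) ∧
        ∀ n x, RightGabrielFilter.quotientsMap M h (D₁.toFun n x) =
          D₂.toFun n (RightGabrielFilter.quotientsMap M h x)) := by
  refine ⟨fun F Δ K hK n => ?_, fun F Δ M _ _ D => ?_, fun F G h Δ M _ _ D D₁ D₂ h₁ h₂ => ?_⟩
  · exact ⟨Δ.comapIdeal K n, Δ.comapIdeal_mem F hK n, fun i hi x hx => hx i hi⟩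
  · exact ⟨D.extend F, D.extend_isExtension F, fun D' hD' => hD'.unique (D.extend_isExtension F)⟩
  · exact ⟨RightGabrielFilter.quotientsMap_toQuotients h, h₁.quotientsMap_toFun h h₂⟩

theorem mainTheorem5 {R : Type u} [Ring R] :
    -- every symmetric Gabriel filter is higher derivation invariant
    (∀ (Fl : LeftGabrielFilter R) (Fr : RightGabrielFilter R) (Δ : HigherDerivation R),
      (symmetricFilter Fl Fr).IsInvariant Δ) ∧
    -- every `Δ`-higher derivation on a bimodule extends uniquely
    (∀ (Fl : LeftGabrielFilter R) (Fr : RightGabrielFilter R) (Δ : HigherDerivation R)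
      (M : Type v) [AddCommGroup M] [Module R M] [Module Rᵐᵒᵖ M] [SMulCommClass R Rᵐᵒᵖ M]
      (D : BimoduleHigherDerivation Δ M),
      ∃! D' : BimoduleHigherDerivation Δ (SymmetricQuotients Fl Fr M), D'.IsExtension D) ∧
    -- for nested symmetric filters the extensions agree
    (∀ (Fl₁ Fl₂ : LeftGabrielFilter R) (Fr₁ Fr₂ : RightGabrielFilter R)
      (h : (symmetricFilter Fl₁ Fr₁).ideals ⊆ (symmetricFilter Fl₂ Fr₂).ideals)
      (Δ : HigherDerivation R)
      (M : Type v) [AddCommGroup M] [Module R M] [Module Rᵐᵒᵖ M] [SMulCommClass R Rᵐᵒᵖ M]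
      (D : BimoduleHigherDerivation Δ M)
      (D₁ : BimoduleHigherDerivation Δ (SymmetricQuotients Fl₁ Fr₁ M))
      (D₂ : BimoduleHigherDerivation Δ (SymmetricQuotients Fl₂ Fr₂ M)),
      D₁.IsExtension D → D₂.IsExtension D →
        BimoduleHigherDerivation.ExtensionsAgree h D D₁ D₂) := by
  obtain ⟨invariant, existsUnique, agree⟩ := mainTheorem5_general.{u, v} (A := Env R)
  refine ⟨fun Fl Fr Δ => invariant (symmetricFilter Fl Fr) Δ.enveloping,
    fun Fl Fr Δ M _ _ _ _ D => ?_, fun Fl₁ Fl₂ Fr₁ Fr₂ h Δ M _ _ _ _ D D₁ D₂ h₁ h₂ => ?_⟩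
  all_goals
    let _ := bimoduleToRight R M
    let e : BimoduleHigherDerivation Δ M ≃ RightHigherDerivation Δ.enveloping M :=
      BimoduleHigherDerivation.equivRight (envAction_tmul R M)
    let e' (Fl Fr) : BimoduleHigherDerivation Δ (SymmetricQuotients Fl Fr M) ≃
        RightHigherDerivation Δ.enveloping ((symmetricFilter Fl Fr).ModuleOfQuotients M) :=
      BimoduleHigherDerivation.equivRight SymmetricQuotients.op_tmul_smul
  · exact ((e' Fl Fr).existsUnique_congr fun _ => Iff.rfl).2 (existsUnique _ _ M (e D))
  · obtain ⟨triangle, square⟩ := agree _ _ h _ M (e D) (e' _ _ D₁) (e' _ _ D₂) h₁ h₂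
    exact ⟨triangle, h₁, h₂, square⟩
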